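/- Let $Q=\prod_{\mathbb{N}}[0,1]$ be the Hilbert cube with the product topology, and let $M$ be a non-empty connected compact Hausdorff space which is a Hilbert cube manifold, i.e. $M$ has an open cover each member of which is homeomorphic to an open subset of $Q$ (such an $M$ is metrizable). Let $\mathcal{H}(M)$ be the group of homeomorphisms of $M$ onto itself with the topology of uniform convergence of homeomorphisms and of their inverses, that is, the topology of the metric $$d(\varphi,\psi)=\max_{x\in M}d_M(\varphi(x),\psi(x))+\max_{x\in M}d_M(\varphi^{-1}(x),\psi^{-1}(x)),$$ where $d_M$ is any metric inducing the topology of $M$, and let $\mathcal{H}_0(M)$ be the path component of the identity in $\mathcal{H}(M)$. Then the action of $\mathcal{H}_0(M)$ on $M$ has the finite filling property: there is an $n\in\mathbb{N}$ such that for every non-empty open set $U\subseteq M$ there are $g_1,\dots,g_n\in\mathcal{H}_0(M)$ with $\bigcup_{i=1}^n g_i(U)=M$. -/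

import Mathlib

open Set Topology

/-- The Hilbert cube `Q = ∏_{ℕ} [0, 1]`, with the product topology. -/
abbrev HilbertCube : Type := ℕ → unitInterval

/-- A space is a Hilbert cube manifold if it has an open cover by sets each of which is
homeomorphic to an open subset of the Hilbert cube. -/
def IsHilbertCubeManifold (M : Type*) [TopologicalSpace M] : Prop :=
  ∀ x : M, ∃ U : Set M, IsOpen U ∧ x ∈ U ∧
    ∃ V : Set HilbertCube, IsOpen V ∧ Nonempty (U ≃ₜ V)

namespace HomeoGroup

variable {X : Type*} [TopologicalSpace X]

/-- A homeomorphism together with its inverse, as a pair of continuous maps. -/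
def toPair (φ : X ≃ₜ X) : C(X, X) × C(X, X) :=
  (⟨φ, φ.continuous⟩, ⟨φ.symm, φ.symm.continuous⟩)

/-- The topology on the homeomorphism group `𝓗(X)`: the coarsest one for which `φ ↦ φ` and
`φ ↦ φ⁻¹` are continuous into `C(X, X)` with the compact-open topology. For a compact space `X`
with metric `d_X`, where the compact-open topology is that of uniform convergence, this is the
topology of the metric
`d(φ, ψ) = max_x d_X(φ(x), ψ(x)) + max_x d_X(φ⁻¹(x), ψ⁻¹(x))`. -/
instance instTopologicalSpace : TopologicalSpace (X ≃ₜ X) :=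
  TopologicalSpace.induced toPair inferInstance

theorem isInducing_toPair : IsInducing (toPair : (X ≃ₜ X) → C(X, X) × C(X, X)) := ⟨rfl⟩

instance instIsTopologicalGroup [LocallyCompactSpace X] : IsTopologicalGroup (X ≃ₜ X) where
  continuous_mul := by
    have h : Continuous (toPair : (X ≃ₜ X) → C(X, X) × C(X, X)) := isInducing_toPair.continuous
    have h1 : Continuous fun p : (X ≃ₜ X) × (X ≃ₜ X) => toPair p.1 := h.comp continuous_fst
    have h2 : Continuous fun p : (X ≃ₜ X) × (X ≃ₜ X) => toPair p.2 := h.comp continuous_snd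
    exact isInducing_toPair.continuous_iff.2 ((h1.fst.compCM h2.fst).prodMk (h2.snd.compCM h1.snd))
  continuous_inv := by
    have h : Continuous (toPair : (X ≃ₜ X) → C(X, X) × C(X, X)) := isInducing_toPair.continuous
    exact isInducing_toPair.continuous_iff.2 (h.snd.prodMk h.fst)

/-- The tautological action of the homeomorphism group `𝓗(X)` on `X`. -/
instance instMulAction : MulAction (X ≃ₜ X) X where
  smul φ x := φ x
  one_smul _ := rfl
  mul_smul _ _ _ := rfl

end HomeoGroup

/-- `𝓗₀(X)`: the path component of the identity in the homeomorphism group `𝓗(X)`. -/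
abbrev HomeoZero (X : Type*) [TopologicalSpace X] [LocallyCompactSpace X] : Subgroup (X ≃ₜ X) :=
  Subgroup.pathComponentOne (X ≃ₜ X)

/-- The `n`-filling property of an action `Γ ↷ X`: for every non-empty open set `U` there are
`g₁, …, gₙ ∈ Γ` with `⋃ i, gᵢ(U) = X`. -/
def HasNFillingProperty (Γ X : Type*) [Group Γ] [TopologicalSpace X] [MulAction Γ X]
    (n : ℕ) : Prop :=
  ∀ U : Set X, IsOpen U → U.Nonempty →
    ∃ g : Fin n → Γ, ⋃ i, (fun x : X => g i • x) '' U = univ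

/-- An action has the finite filling property if it has the `n`-filling property for some `n`
(the same `n` for all non-empty open sets). -/
def HasFiniteFillingProperty (Γ X : Type*) [Group Γ] [TopologicalSpace X] [MulAction Γ X] : Prop :=
  ∃ n : ℕ, HasNFillingProperty Γ X n

/-!
A non-empty open set `U` fills a compact connected Hilbert cube manifold `M` in a number of
translates independent of `U` because every point of `M` has a neighbourhood which some element of
`𝓗₀(M)` moves into `U`, for every `U` (`IsHilbertCubeManifold.exists_nhds_absorbed`). Finitely many
such neighbourhoods cover `M`, and their number does for all `U`. By connectedness it is enough to
treat sets `U` inside a chart around the point: the union of the translates of `U` is clopen.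

In a chart, the neighbourhood is a part `{q z ≤ c}` of a box `∏ O k` in the Hilbert cube, with
`c < 1`, where only the coordinates in a finite set `F` are restricted and `z ∉ F`. It has to be
moved into a smaller box which restricts many more coordinates, by isotopies supported in a box
`∏ J k` restricting only the coordinates in `F` (`exists_isotopy_cube`). A homeomorphism of `[0, 1]`
fixes or exchanges its end points, so a coordinate equal to `0` or `1` cannot be corrected on its
own. But in the square the end points can be avoided: where the second coordinate is small, the
first one can be pushed around the corner away from `0` (`exists_isotopy_corner`), and similarly
away from `1`, and then along the interval to wherever it should be (`exists_isotopy_interval`).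
Altogether (`exists_isotopy_square`) a coordinate that is known to be small serves as a helper to
correct any other coordinate, and does not increase. So `z` is first made small and serves as helper
to correct all other coordinates which the target box restricts, and to make small one coordinate
`w` which the target box does not restrict; then `w` serves as helper to correct `z` itself.

The isotopies of the square are made to act on two coordinates of the cube, slowed down by a cutoff
function of the coordinates in `F` (`exists_isotopy_onCoordinates`), transferred to `M` by the
chart, and extended by the identity (`AmbientIsotopy.transfer`). By compactness, an isotopy of `M`
is a path in the homeomorphism group (`AmbientIsotopy.toHomeomorph_mem_homeoZero`).
-/

open scoped unitInterval

/-! ### Ambient isotopies -/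

/-- An ambient isotopy of `X`: a jointly continuous family of bijections `X → X`, indexed by
`[0, 1]`, which starts at the identity. Continuity of the inverses is not required: it is automatic
when `X` is compact and Hausdorff. -/
structure AmbientIsotopy (X : Type*) [TopologicalSpace X] where
  /-- The family of maps. -/
  toFun : I → X → X
  continuous_toFun : Continuous fun p : I × X => toFun p.1 p.2
  bijective_toFun : ∀ t, Function.Bijective (toFun t)
  toFun_zero : ∀ x, toFun 0 x = x

namespace AmbientIsotopy

variable {X Y : Type*} [TopologicalSpace X] [TopologicalSpace Y]

instance : CoeFun (AmbientIsotopy X) fun _ => I → X → X := ⟨toFun⟩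

/-- All maps of the isotopy are the identity outside `S`. -/
def SupportedOn (H : AmbientIsotopy X) (S : Set X) : Prop :=
  ∀ t, ∀ x ∉ S, H t x = x

theorem SupportedOn.mono {H : AmbientIsotopy X} {S T : Set X} (h : H.SupportedOn S)
    (hST : S ⊆ T) : H.SupportedOn T :=
  fun t x hx => h t x fun hS => hx (hST hS)

/-- The constant isotopy. -/
def refl (X : Type*) [TopologicalSpace X] : AmbientIsotopy X where
  toFun _ x := x
  continuous_toFun := continuous_snd
  bijective_toFun _ := Function.bijective_id
  toFun_zero _ := rfl

/-- The isotopy `t ↦ Hₜ ∘ Gₜ`. -/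
def comp (H G : AmbientIsotopy X) : AmbientIsotopy X where
  toFun t x := H t (G t x)
  continuous_toFun :=
    H.continuous_toFun.comp (continuous_fst.prodMk G.continuous_toFun)
  bijective_toFun t := (H.bijective_toFun t).comp (G.bijective_toFun t)
  toFun_zero x := by rw [G.toFun_zero, H.toFun_zero]

@[simp] theorem comp_apply (H G : AmbientIsotopy X) (t : I) (x : X) :
    H.comp G t x = H t (G t x) := rfl

theorem SupportedOn.comp {H G : AmbientIsotopy X} {S T : Set X} (hH : H.SupportedOn S)
    (hG : G.SupportedOn T) : (H.comp G).SupportedOn (S ∪ T) := fun t x hx => by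
  rw [comp_apply, hG t x fun h => hx (.inr h), hH t x fun h => hx (.inl h)]

/-- The conjugate of an isotopy of `X` by a homeomorphism `Y ≃ₜ X`. -/
def conj (H : AmbientIsotopy X) (e : Y ≃ₜ X) : AmbientIsotopy Y where
  toFun t y := e.symm (H t (e y))
  continuous_toFun := e.symm.continuous.comp
    (H.continuous_toFun.comp (continuous_fst.prodMk (e.continuous.comp continuous_snd)))
  bijective_toFun t := e.symm.bijective.comp ((H.bijective_toFun t).comp e.bijective)
  toFun_zero y := by rw [H.toFun_zero, e.symm_apply_apply]

@[simp] theorem conj_apply (H : AmbientIsotopy X) (e : Y ≃ₜ X) (t : I) (y : Y) :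
    H.conj e t y = e.symm (H t (e y)) := rfl

theorem SupportedOn.conj {H : AmbientIsotopy X} {S : Set X} (h : H.SupportedOn S) (e : Y ≃ₜ X) :
    (H.conj e).SupportedOn (e ⁻¹' S) := fun t y hy => by
  rw [conj_apply, h t _ hy, e.symm_apply_apply]

/-- The isotopy of `X × Y` acting on the first factor. -/
def prodRefl (H : AmbientIsotopy X) (Y : Type*) [TopologicalSpace Y] :
    AmbientIsotopy (X × Y) where
  toFun t p := (H t p.1, p.2)
  continuous_toFun := (H.continuous_toFun.comp
    (continuous_fst.prodMk (continuous_fst.comp continuous_snd))).prodMk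
      (continuous_snd.comp continuous_snd)
  bijective_toFun t := (H.bijective_toFun t).prodMap Function.bijective_id
  toFun_zero p := by rw [H.toFun_zero]

@[simp] theorem prodRefl_apply (H : AmbientIsotopy X) (t : I) (p : X × Y) :
    H.prodRefl Y t p = (H t p.1, p.2) := rfl

theorem SupportedOn.prodRefl {H : AmbientIsotopy X} {S : Set X} (h : H.SupportedOn S) :
    (H.prodRefl Y).SupportedOn (S ×ˢ univ) := fun t p hp => by
  rw [prodRefl_apply, h t p.1 fun hS => hp ⟨hS, mem_univ _⟩]

/-- The restriction of an isotopy of `X` to an embedded subspace which all of its maps preserve,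
together with its complement. -/
noncomputable def restrict (H : AmbientIsotopy X) {ι : Y → X} (hι : IsEmbedding ι)
    (h : ∀ t x, H t x ∈ range ι ↔ x ∈ range ι) : AmbientIsotopy Y where
  toFun t y := ((h t (ι y)).2 (mem_range_self y)).choose
  continuous_toFun := by
    refine hι.continuous_iff.2 ?_
    have : (ι ∘ fun p : I × Y => ((h p.1 (ι p.2)).2 (mem_range_self p.2)).choose) =
        fun p => H p.1 (ι p.2) :=
      funext fun p => ((h p.1 (ι p.2)).2 (mem_range_self p.2)).choose_spec
    rw [this]
    exact H.continuous_toFun.comp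
      (continuous_fst.prodMk (hι.continuous.comp continuous_snd))
  bijective_toFun t := by
    have key : ∀ y, ι ((h t (ι y)).2 (mem_range_self y)).choose = H t (ι y) :=
      fun y => ((h t (ι y)).2 (mem_range_self y)).choose_spec
    constructor
    · intro y y' hy
      have := congrArg ι hy
      simp only [key] at this
      exact hι.injective ((H.bijective_toFun t).1 this)
    · intro y
      obtain ⟨x, hx⟩ := (H.bijective_toFun t).2 (ι y)
      obtain ⟨z, rfl⟩ := (h t x).1 ⟨y, hx.symm⟩
      exact ⟨z, hι.injective (by rw [key, hx])⟩
  toFun_zero y := hι.injective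
    ((((h 0 (ι y)).2 (mem_range_self y)).choose_spec).trans (H.toFun_zero _))

theorem restrict_apply (H : AmbientIsotopy X) {ι : Y → X} (hι : IsEmbedding ι)
    (h : ∀ t x, H t x ∈ range ι ↔ x ∈ range ι) (t : I) (y : Y) :
    ι (H.restrict hι h t y) = H t (ι y) :=
  ((h t (ι y)).2 (mem_range_self y)).choose_spec

end AmbientIsotopy

/-! ### Pushing along an interval -/

/-- For `0 ≤ a` and `c ≤ d`, the piecewise linear homeomorphism of the line which is the identity
outside `[c, d]` and on `[c, d]` is the smaller of the linear function of slope `exp a` fixing `c`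
and that of slope `exp (-a)` fixing `d`. -/
noncomputable def pushRight (a c d x : ℝ) : ℝ :=
  max x (min (c + Real.exp a * (x - c)) (d - Real.exp (-a) * (d - x)))

/-- The inverse of `pushRight a c d`. -/
noncomputable def pushRightInv (a c d y : ℝ) : ℝ :=
  min y (max (c + Real.exp (-a) * (y - c)) (d - Real.exp a * (d - y)))

section pushRight

variable {a c d x : ℝ}

theorem pushRight_strictMono (a c d : ℝ) : StrictMono (pushRight a c d) := by
  intro x y h
  have h1 := Real.exp_pos a
  have h2 := Real.exp_pos (-a)
  refine max_lt_max h (min_lt_min ?_ ?_) <;> nlinarith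

theorem pushRight_pushRightInv (a c d y : ℝ) :
    pushRight a c d (pushRightInv a c d y) = y := by
  have h1 := Real.exp_pos a
  have h2 := Real.exp_pos (-a)
  have h3 : Real.exp a * Real.exp (-a) = 1 := by rw [← Real.exp_add]; simp
  set k := pushRightInv a c d y with hk
  have e1 : c + Real.exp a * ((c + Real.exp (-a) * (y - c)) - c) = y := by
    linear_combination (y - c) * h3
  have e2 : d - Real.exp (-a) * (d - (d - Real.exp a * (d - y))) = y := by
    linear_combination (y - d) * h3
  have hky : k ≤ y := min_le_left _ _
  apply le_antisymm
  · refine max_le hky ?_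
    rcases le_max_iff.1 (min_le_right _ _ : k ≤ _) with h | h
    · refine (min_le_left _ _).trans ?_
      rw [← e1]
      have : k ≤ c + Real.exp (-a) * (y - c) := h
      gcongr
    · refine (min_le_right _ _).trans ?_
      conv_rhs => rw [← e2]
      have : k ≤ d - Real.exp a * (d - y) := h
      gcongr
  · rcases min_choice y (max (c + Real.exp (-a) * (y - c)) (d - Real.exp a * (d - y))) with h | h
    · exact le_max_of_le_left (by rw [hk, pushRightInv, h])
    · have hk' : k = max (c + Real.exp (-a) * (y - c)) (d - Real.exp a * (d - y)) := h
      refine le_max_of_le_right (le_min ?_ ?_)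
      · conv_lhs => rw [← e1]
        have : c + Real.exp (-a) * (y - c) ≤ k := hk' ▸ le_max_left _ _
        gcongr
      · conv_lhs => rw [← e2]
        have : d - Real.exp a * (d - y) ≤ k := hk' ▸ le_max_right _ _
        gcongr

theorem pushRightInv_pushRight (a c d x : ℝ) :
    pushRightInv a c d (pushRight a c d x) = x :=
  (pushRight_strictMono a c d).injective (pushRight_pushRightInv a c d _)

theorem le_pushRight (a c d x : ℝ) : x ≤ pushRight a c d x := le_max_left _ _

theorem pushRight_zero (c d x : ℝ) : pushRight 0 c d x = x := by simp [pushRight]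

theorem pushRight_of_le (ha : 0 ≤ a) (h : x ≤ c) : pushRight a c d x = x := by
  have h1 := Real.one_le_exp ha
  exact max_eq_left ((min_le_left _ _).trans (by nlinarith))

theorem pushRight_of_ge (ha : 0 ≤ a) (h : d ≤ x) : pushRight a c d x = x := by
  have h1 : Real.exp (-a) ≤ 1 := Real.exp_le_one_iff.2 (by linarith)
  exact max_eq_left ((min_le_right _ _).trans (by nlinarith))

theorem pushRight_le (ha : 0 ≤ a) (h : x ≤ d) : pushRight a c d x ≤ d :=
  ((pushRight_strictMono a c d).monotone h).trans_eq (pushRight_of_ge ha le_rfl)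

theorem pushRight_lt (ha : 0 ≤ a) (h : x < d) : pushRight a c d x < d :=
  ((pushRight_strictMono a c d) h).trans_eq (pushRight_of_ge ha le_rfl)

theorem continuous_pushRight :
    Continuous fun p : ℝ × ℝ × ℝ × ℝ => pushRight p.1 p.2.1 p.2.2.1 p.2.2.2 := by
  unfold pushRight; fun_prop

/-- An interval containing `[c, d]` is preserved, and so is its complement. -/
theorem pushRight_mem_Icc_iff {l u : ℝ} (ha : 0 ≤ a) (hl : l ≤ c) (hu : d ≤ u) :
    pushRight a c d x ∈ Icc l u ↔ x ∈ Icc l u := by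
  rcases le_total x c with h | h
  · rw [pushRight_of_le ha h]
  rcases le_total d x with h' | h'
  · rw [pushRight_of_ge ha h']
  · have := le_pushRight a c d x
    have := pushRight_le (c := c) ha h'
    constructor <;> intro _ <;> constructor <;> linarith

theorem exists_le_pushRight {c' e : ℝ} (hc : c < c') (he : e < d) :
    ∃ a, 0 ≤ a ∧ e ≤ pushRight a c d c' := by
  refine ⟨max 0 (max ((e - c) / (c' - c)) ((d - c') / (d - e))), le_max_left _ _, ?_⟩
  set a := max 0 (max ((e - c) / (c' - c)) ((d - c') / (d - e)))
  have hE : a ≤ Real.exp a := by linarith [Real.add_one_le_exp a]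
  have h1 : (e - c) / (c' - c) ≤ Real.exp a :=
    ((le_max_left _ _).trans (le_max_right _ _)).trans hE
  have h2 : (d - c') / (d - e) ≤ Real.exp a :=
    ((le_max_right _ _).trans (le_max_right _ _)).trans hE
  rw [div_le_iff₀ (by linarith)] at h1 h2
  refine le_max_of_le_right (le_min (by linarith) ?_)
  have h3 : Real.exp (-a) * (d - c') ≤ Real.exp (-a) * (Real.exp a * (d - e)) := by gcongr
  rw [← mul_assoc, ← Real.exp_add] at h3
  simp only [neg_add_cancel, Real.exp_zero, one_mul] at h3
  linarith

end pushRight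

/-- `pushRight`, run from the identity, as an isotopy of the line. -/
noncomputable def pushRightIsotopy (a c d : ℝ) : AmbientIsotopy ℝ where
  toFun t x := pushRight (t * a) c d x
  continuous_toFun := by
    have : Continuous fun p : I × ℝ => ((p.1 : ℝ) * a, c, d, p.2) := by fun_prop
    exact continuous_pushRight.comp this
  bijective_toFun t := ⟨(pushRight_strictMono _ c d).injective,
    fun y => ⟨_, pushRight_pushRightInv _ c d y⟩⟩
  toFun_zero x := by simp [pushRight_zero]

theorem exists_isotopy_push_right {c c' e d : ℝ} (hc0 : 0 ≤ c) (hc : c < c') (he : e < d)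
    (hd : d ≤ 1) :
    ∃ H : AmbientIsotopy I, H.SupportedOn {x | (x : ℝ) ∈ Icc c d} ∧
      (∀ x : I, c' ≤ x → e ≤ H 1 x) ∧ Monotone (H 1) ∧
      (∀ x : I, (x : ℝ) < d → (H 1 x : ℝ) < d) ∧ ∀ x : I, (x : ℝ) ≤ d → (H 1 x : ℝ) ≤ d := by
  obtain ⟨a, ha, hae⟩ := exists_le_pushRight hc he
  have hta : ∀ t : I, 0 ≤ (t : ℝ) * a := fun t => mul_nonneg t.2.1 ha
  have hr : ∀ (t : I) (x : ℝ), pushRightIsotopy a c d t x ∈ range (Subtype.val : I → ℝ) ↔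
      x ∈ range (Subtype.val : I → ℝ) := fun t x => by
    rw [Subtype.range_coe]
    exact pushRight_mem_Icc_iff (hta t) hc0 hd
  have key : ∀ t x : I, (((pushRightIsotopy a c d).restrict IsEmbedding.subtypeVal hr t x : I) : ℝ)
      = pushRight (t * a) c d x := fun t x => AmbientIsotopy.restrict_apply _ _ hr t x
  refine ⟨(pushRightIsotopy a c d).restrict IsEmbedding.subtypeVal hr,
    fun t x hx => Subtype.ext ?_, fun x hx => ?_, fun x y hxy => ?_, fun x hx => ?_,
    fun x hx => ?_⟩
  · rw [key]
    rcases not_and_or.1 hx with h | h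
    · exact pushRight_of_le (hta t) (not_le.1 h).le
    · exact pushRight_of_ge (hta t) (not_le.1 h).le
  · rw [key]
    simp only [Icc.coe_one, one_mul]
    exact hae.trans ((pushRight_strictMono a c d).monotone hx)
  · rw [← Subtype.coe_le_coe, key, key]
    exact (pushRight_strictMono _ c d).monotone hxy
  · rw [key]
    exact pushRight_lt (hta 1) hx
  · rw [key]
    exact pushRight_le (hta 1) hx

theorem exists_isotopy_push_left {c e d' d : ℝ} (hc0 : 0 ≤ c) (he : c < e) (hd' : d' < d)
    (hd : d ≤ 1) :
    ∃ H : AmbientIsotopy I, H.SupportedOn {x | (x : ℝ) ∈ Icc c d} ∧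
      (∀ x : I, x ≤ d' → H 1 x ≤ e) ∧ ∀ x : I, c ≤ x → c ≤ H 1 x := by
  obtain ⟨H, hs, he, -, -, hH⟩ := exists_isotopy_push_right (c := 1 - d) (c' := 1 - d')
    (e := 1 - e) (d := 1 - c) (by linarith) (by linarith) (by linarith) (by linarith)
  have hσ : ∀ x : I, ((unitInterval.symmHomeomorph x : I) : ℝ) = 1 - x := fun x => rfl
  have hσ' : ∀ x : I, ((unitInterval.symmHomeomorph.symm x : I) : ℝ) = 1 - x := fun x => rfl
  refine ⟨H.conj unitInterval.symmHomeomorph, (hs.conj _).mono fun x hx => ?_, fun x hx => ?_,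
    fun x hx => ?_⟩
  · have h : ((unitInterval.symmHomeomorph x : I) : ℝ) ∈ Icc (1 - d) (1 - c) := hx
    rw [hσ] at h
    exact ⟨by linarith [h.2], by linarith [h.1]⟩
  · have := he (unitInterval.symmHomeomorph x) (by rw [hσ]; linarith)
    rw [AmbientIsotopy.conj_apply, hσ']
    linarith
  · have := hH (unitInterval.symmHomeomorph x) (by rw [hσ]; linarith)
    rw [AmbientIsotopy.conj_apply, hσ']
    linarith

/-- A compact subset of an open interval `J ⊆ (0, 1)` can be pushed into any open subset of `J`
inside `J`. -/
theorem exists_isotopy_interval {J O K : Set I} (hJ : IsOpen J) (hJc : J.OrdConnected)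
    (hJ0 : 0 ∉ J) (hJ1 : 1 ∉ J) (hO : IsCompact O) (hOJ : O ⊆ J) (hK : IsOpen K)
    (hKn : K.Nonempty) (hKJ : K ⊆ J) :
    ∃ C, IsCompact C ∧ C ⊆ J ∧ ∃ H : AmbientIsotopy I, H.SupportedOn C ∧ ∀ x ∈ O, H 1 x ∈ K := by
  obtain ⟨k, hk⟩ := hKn
  have hO' : IsCompact (insert k O) := hO.insert k
  have hO'J : insert k O ⊆ J := insert_subset (hKJ hk) hOJ
  obtain ⟨c', hc', hcl⟩ := hO'.exists_isLeast ⟨k, mem_insert _ _⟩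
  obtain ⟨d', hd', hdu⟩ := hO'.exists_isGreatest ⟨k, mem_insert _ _⟩
  have hc'0 : (0 : ℝ) < c' :=
    unitInterval.coe_pos.2 (unitInterval.pos_iff_ne_zero.2 fun h => hJ0 (h ▸ hO'J hc'))
  have hd'1 : (d' : ℝ) < 1 :=
    unitInterval.coe_lt_one.2 (unitInterval.lt_one_iff_ne_one.2 fun h => hJ1 (h ▸ hO'J hd'))
  obtain ⟨r, hr, hrJ⟩ := Metric.isOpen_iff.1 hJ c' (hO'J hc')
  obtain ⟨r', hr', hrJ'⟩ := Metric.isOpen_iff.1 hJ d' (hO'J hd')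
  obtain ⟨η, hη, hηK⟩ := Metric.isOpen_iff.1 hK k hk
  have hck : (c' : ℝ) ≤ k := hcl (mem_insert _ _)
  have hkd : (k : ℝ) ≤ d' := hdu (mem_insert _ _)
  -- A compact interval `[c, d]` in `J` whose interior contains both `O` and `k`.
  obtain ⟨c, hc0, hcc, hcr⟩ : ∃ c : ℝ, 0 ≤ c ∧ c < c' ∧ c' - r < c :=
    ⟨max 0 (c' - r / 2), le_max_left _ _, max_lt hc'0 (by linarith),
      lt_max_of_lt_right (by linarith)⟩
  obtain ⟨d, hd1, hdd, hdr⟩ : ∃ d : ℝ, d ≤ 1 ∧ d' < d ∧ d < d' + r' :=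
    ⟨min 1 (d' + r' / 2), min_le_left _ _, lt_min hd'1 (by linarith),
      min_lt_of_right_lt (by linarith)⟩
  have hcJ : (⟨c, hc0, by linarith [c'.2.2]⟩ : I) ∈ J := hrJ (by
    rw [Metric.mem_ball, Subtype.dist_eq, Real.dist_eq, abs_lt]
    constructor <;> simp only <;> linarith)
  have hdJ : (⟨d, by linarith [d'.2.1], hd1⟩ : I) ∈ J := hrJ' (by
    rw [Metric.mem_ball, Subtype.dist_eq, Real.dist_eq, abs_lt]
    constructor <;> simp only <;> linarith)
  obtain ⟨H₁, hs₁, h₁, hm, hlt, -⟩ := exists_isotopy_push_right hc0 hcc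
    (e := k - η / 2) (by linarith) hd1
  obtain ⟨H₂, hs₂, h₂, h₂'⟩ := exists_isotopy_push_left (c := max c (k - 3 * η / 4))
    (e := k + η / 2) (d' := H₁ 1 d') (hc0.trans (le_max_left _ _))
    (max_lt (by linarith) (by linarith)) (hlt d' hdd) hd1
  refine ⟨{x | (x : ℝ) ∈ Icc c d}, (isClosed_Icc.preimage continuous_subtype_val).isCompact,
    fun x hx => hJc.out hcJ hdJ ⟨hx.1, hx.2⟩, H₂.comp H₁,
    (hs₂.comp hs₁).mono (union_subset (fun x hx => ⟨(le_max_left _ _).trans hx.1, hx.2⟩)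
      subset_rfl), fun x hx => hηK ?_⟩
  have hx1 : (x : ℝ) ≤ d' := hdu (mem_insert_of_mem _ hx)
  have hx2 : (c' : ℝ) ≤ x := hcl (mem_insert_of_mem _ hx)
  have h3 := h₂ (H₁ 1 x) (hm hx1)
  have h4 := h₁ x hx2
  have h7 : c ≤ H₁ 1 x := by
    by_contra hlt'
    have : H₁ 1 (H₁ 1 x) = H₁ 1 x := hs₁ 1 _ fun h => hlt' h.1
    have := (H₁.bijective_toFun 1).1 this
    rw [this] at hlt'
    linarith
  have h8 := h₂' (H₁ 1 x) (max_le h7 (by linarith))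
  have h9 := (le_max_right _ _).trans h8
  rw [Metric.mem_ball, Subtype.dist_eq, Real.dist_eq, abs_lt, AmbientIsotopy.comp_apply]
  constructor <;> linarith

/-! ### Pushing around a corner of the square -/

/-- The unfolding of the corner of the quadrant at the origin, as a bijection of the plane: it maps
the quadrant onto the upper half plane, taking its two edges to the two halves of the line. -/
def unfoldCorner : ℝ × ℝ ≃ ℝ × ℝ where
  toFun p := (p.1 - p.2, min p.1 p.2)
  invFun q := (q.2 + max q.1 0, q.2 + max (-q.1) 0)
  left_inv p := by
    rcases le_total p.1 p.2 with h | h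
    · ext <;> simp [h]
    · ext <;> simp [h]
  right_inv q := by
    rcases le_total q.1 0 with h | h
    · ext <;> simp [h]
    · ext <;> simp [h]

/-- The horizontal push to the right along the segments which `unfoldCorner` makes of the points
`(x, y)` with `x, y ≤ R` and a given value of `min x y`. -/
noncomputable def unfoldedPush (a R : ℝ) : ℝ × ℝ ≃ ℝ × ℝ where
  toFun q := (pushRight a (-max (R - q.2) 0) (max (R - q.2) 0) q.1, q.2)
  invFun q := (pushRightInv a (-max (R - q.2) 0) (max (R - q.2) 0) q.1, q.2)
  left_inv q := by ext <;> simp [pushRightInv_pushRight]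
  right_inv q := by ext <;> simp [pushRight_pushRightInv]

/-- The isotopy of the plane pushing the square `[0, R] × [0, R]` around the corner `(0, 0)`, from
the vertical edge towards the horizontal one. -/
noncomputable def cornerIsotopy (a R : ℝ) : AmbientIsotopy (ℝ × ℝ) where
  toFun t p := unfoldCorner.symm (unfoldedPush (t * a) R (unfoldCorner p))
  continuous_toFun := by
    have h : Continuous fun p : I × ℝ × ℝ =>
        ((p.1 : ℝ) * a, -max (R - min p.2.1 p.2.2) 0, max (R - min p.2.1 p.2.2) 0,
          p.2.1 - p.2.2) := by fun_prop
    have h' := continuous_pushRight.comp h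
    have h2 : Continuous fun p : I × ℝ × ℝ => min p.2.1 p.2.2 := by fun_prop
    exact (h2.add (h'.max continuous_const)).prodMk (h2.add (h'.neg.max continuous_const))
  bijective_toFun t := unfoldCorner.symm.bijective.comp
    ((unfoldedPush _ R).bijective.comp unfoldCorner.bijective)
  toFun_zero p := by simp [unfoldedPush, pushRight_zero]

theorem unfoldCorner_mem_iff (p : ℝ × ℝ) :
    p ∈ Icc (0 : ℝ) 1 ×ˢ Icc (0 : ℝ) 1 ↔ 0 ≤ (unfoldCorner p).2 ∧
      (unfoldCorner p).1 ∈ Icc (-(1 - (unfoldCorner p).2)) (1 - (unfoldCorner p).2) := by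
  simp only [unfoldCorner, Equiv.coe_fn_mk, mem_prod, mem_Icc]
  rcases le_total p.1 p.2 with h | h
  · simp only [min_eq_left h]
    constructor
    · rintro ⟨⟨_, _⟩, _, _⟩; refine ⟨?_, ?_, ?_⟩ <;> linarith
    · rintro ⟨_, _, _⟩; refine ⟨⟨?_, ?_⟩, ?_, ?_⟩ <;> linarith
  · simp only [min_eq_right h]
    constructor
    · rintro ⟨⟨_, _⟩, _, _⟩; refine ⟨?_, ?_, ?_⟩ <;> linarith
    · rintro ⟨_, _, _⟩; refine ⟨⟨?_, ?_⟩, ?_, ?_⟩ <;> linarith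

theorem cornerIsotopy_mem_iff {a R : ℝ} (ha : 0 ≤ a) (hR : R ≤ 1) (t : I) (p : ℝ × ℝ) :
    cornerIsotopy a R t p ∈ Icc (0 : ℝ) 1 ×ˢ Icc (0 : ℝ) 1 ↔
      p ∈ Icc (0 : ℝ) 1 ×ˢ Icc (0 : ℝ) 1 := by
  rw [unfoldCorner_mem_iff, unfoldCorner_mem_iff p]
  simp only [cornerIsotopy, Equiv.apply_symm_apply]
  set q := unfoldCorner p
  simp only [unfoldedPush, Equiv.coe_fn_mk]
  refine and_congr_right fun _ => ?_
  have hta : 0 ≤ (t : ℝ) * a := mul_nonneg t.2.1 ha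
  rcases le_or_gt q.2 1 with h | h
  · have hm : max (R - q.2) 0 ≤ 1 - q.2 := max_le (by linarith) (by linarith)
    exact pushRight_mem_Icc_iff hta (by linarith) hm
  · rw [Icc_eq_empty (by linarith)]; simp

theorem cornerIsotopy_of_le {a R : ℝ} (ha : 0 ≤ a) (t : I) {p : ℝ × ℝ} (hp : R ≤ p.1) :
    cornerIsotopy a R t p = p := by
  have hta : 0 ≤ (t : ℝ) * a := mul_nonneg t.2.1 ha
  have h : unfoldedPush (t * a) R (unfoldCorner p) = unfoldCorner p := by
    ext
    · simp only [unfoldCorner, unfoldedPush, Equiv.coe_fn_mk]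
      rcases le_total p.1 p.2 with h | h
      · rw [min_eq_left h, max_eq_right (by linarith)]
        exact pushRight_of_le hta (by linarith)
      · rw [min_eq_right h]
        exact pushRight_of_ge hta (max_le (by linarith) (by linarith))
    · rfl
  simp [cornerIsotopy, h]

/-- The time-one map takes points near the horizontal edge of the corner away from the vertical
edge. Slopes `10` and `1 / 10` suffice to push from `-R / 4` beyond `R / 2` on the unfolded
segments. -/
theorem cornerIsotopy_one {R : ℝ} {p : ℝ × ℝ} (hp0 : 0 ≤ p.1) (hpR : p.1 ≤ R) (hp2 : 0 ≤ p.2)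
    (hp : p.2 ≤ R / 4) :
    (cornerIsotopy (Real.log 10) R 1 p).1 ∈ Icc (R / 2) R ∧
      (cornerIsotopy (Real.log 10) R 1 p).2 ≤ p.2 := by
  simp only [cornerIsotopy, unfoldCorner, unfoldedPush, Equiv.coe_fn_mk, Equiv.coe_fn_symm_mk,
    Icc.coe_one, one_mul]
  set v := min p.1 p.2 with hv
  have hv2 : v ≤ p.2 := min_le_right _ _
  have hv1 : v ≤ p.1 := min_le_left _ _
  have hv0 : 0 ≤ v := le_min hp0 hp2
  rw [max_eq_left (show (0 : ℝ) ≤ R - v by linarith)]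
  set h := pushRight (Real.log 10) (-(R - v)) (R - v) (p.1 - p.2) with hh
  have hsub : p.1 - p.2 ≤ R - v := by linarith
  have h1 : h ≤ R - v := pushRight_le (Real.log_nonneg (by norm_num)) hsub
  have h2 : R / 2 ≤ h := by
    refine le_max_of_le_right (le_min ?_ ?_)
    · rw [Real.exp_log (by norm_num)]
      linarith
    · rw [Real.exp_neg, Real.exp_log (by norm_num)]
      linarith
  have h0 : 0 ≤ h := by linarith
  rw [max_eq_left h0, max_eq_right (by linarith)]
  exact ⟨⟨by linarith, by linarith⟩, by linarith⟩

theorem exists_isotopy_corner {R : ℝ} (hR : R ≤ 1) :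
    ∃ H : AmbientIsotopy (I × I), H.SupportedOn ({x : I | (x : ℝ) ≤ R} ×ˢ univ) ∧
      ∀ p : I × I, (p.2 : ℝ) ≤ R / 4 → (H 1 p).2 ≤ p.2 ∧
        ((R ≤ p.1 ∧ (H 1 p).1 = p.1) ∨ ((H 1 p).1 : ℝ) ∈ Icc (R / 2) R) := by
  have hι : IsEmbedding (Prod.map Subtype.val Subtype.val : I × I → ℝ × ℝ) :=
    IsEmbedding.subtypeVal.prodMap IsEmbedding.subtypeVal
  have hlog : 0 ≤ Real.log 10 := Real.log_nonneg (by norm_num)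
  have hr : ∀ (t : I) (x : ℝ × ℝ), cornerIsotopy (Real.log 10) R t x ∈
      range (Prod.map Subtype.val Subtype.val : I × I → ℝ × ℝ) ↔
      x ∈ range (Prod.map Subtype.val Subtype.val : I × I → ℝ × ℝ) := fun t x => by
    rw [range_prodMap, Subtype.range_coe]
    exact cornerIsotopy_mem_iff hlog hR t x
  have key : ∀ (t : I) (p : I × I), Prod.map Subtype.val Subtype.val
      ((cornerIsotopy (Real.log 10) R).restrict hι hr t p) =
      cornerIsotopy (Real.log 10) R t (p.1, p.2) :=
    fun t p => AmbientIsotopy.restrict_apply _ _ hr t p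
  have fixed : ∀ (t : I) (p : I × I), R ≤ p.1 →
      (cornerIsotopy (Real.log 10) R).restrict hι hr t p = p := fun t p hp =>
    hι.injective ((key t p).trans (cornerIsotopy_of_le hlog t hp))
  refine ⟨(cornerIsotopy (Real.log 10) R).restrict hι hr, fun t p hp => fixed t p ?_,
    fun p hp => ?_⟩
  · by_contra h
    exact hp ⟨(not_le.1 h).le, mem_univ _⟩
  · rcases le_total R p.1 with h | h
    · exact ⟨by rw [fixed 1 p h], .inl ⟨h, by rw [fixed 1 p h]⟩⟩
    · have := cornerIsotopy_one (p := ((p.1 : ℝ), (p.2 : ℝ))) p.1.2.1 h p.2.2.1 hp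
      rw [← key] at this
      exact ⟨this.2, .inr this.1⟩

/-- Near the edge `{y = 0}` of the square, the first coordinate can be moved away from `0`. -/
theorem exists_isotopy_avoid_zero {J O : Set I} (hJ : IsOpen J) (hO : IsCompact O) (hOJ : O ⊆ J) :
    ∃ δ : ℝ, 0 < δ ∧ ∃ C, IsCompact C ∧ C ⊆ J ∧ ∃ O', IsCompact O' ∧ O' ⊆ J ∧ 0 ∉ O' ∧
      (1 ∈ O' → 1 ∈ O) ∧ ∃ H : AmbientIsotopy (I × I), H.SupportedOn (C ×ˢ univ) ∧
        ∀ p : I × I, p.1 ∈ O → (p.2 : ℝ) ≤ δ → (H 1 p).2 ≤ p.2 ∧ (H 1 p).1 ∈ O' := by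
  by_cases h0 : (0 : I) ∈ J
  · obtain ⟨r, hr, hrJ⟩ := Metric.isOpen_iff.1 hJ 0 h0
    obtain ⟨R, hR0, hR1, hRr⟩ : ∃ R : ℝ, 0 < R ∧ R ≤ 1 / 2 ∧ R < r :=
      ⟨min (1 / 2) (r / 2), lt_min (by norm_num) (by linarith), min_le_left _ _,
        min_lt_of_right_lt (by linarith)⟩
    obtain ⟨H, hs, hH⟩ := exists_isotopy_corner (R := R) (by linarith)
    have hsub : {x : I | (x : ℝ) ≤ R} ⊆ J := fun x (hx : (x : ℝ) ≤ R) => hrJ (by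
      rw [Metric.mem_ball, Subtype.dist_eq, Real.dist_eq, Icc.coe_zero, sub_zero,
        abs_of_nonneg x.2.1]
      linarith)
    refine ⟨R / 4, by linarith, _, (isClosed_Iic.preimage continuous_subtype_val).isCompact, hsub,
      (O ∩ {x | R ≤ (x : ℝ)}) ∪ {x : I | (x : ℝ) ∈ Icc (R / 2) R},
      (hO.inter_right (isClosed_Ici.preimage continuous_subtype_val)).union
        (isClosed_Icc.preimage continuous_subtype_val).isCompact,
      union_subset (inter_subset_left.trans hOJ) fun x hx => hsub hx.2, ?_, ?_, H, hs,
      fun p hpO hp => ?_⟩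
    · rintro (⟨-, h⟩ | h)
      · have : R ≤ 0 := h
        linarith
      · have : R / 2 ≤ 0 := h.1
        linarith
    · rintro (h | h)
      · exact h.1
      · have : (1 : ℝ) ≤ R := h.2
        linarith
    · obtain ⟨h1, ⟨h2, h3⟩ | h2⟩ := hH p hp
      · exact ⟨h1, .inl ⟨h3 ▸ hpO, h3 ▸ h2⟩⟩
      · exact ⟨h1, .inr h2⟩
  · exact ⟨1, one_pos, ∅, isCompact_empty, empty_subset _, O, hO, hOJ, fun h => h0 (hOJ h), id,
      .refl _, fun _ _ _ => rfl, fun p hp _ => ⟨le_rfl, hp⟩⟩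

theorem exists_isotopy_avoid_one {J O : Set I} (hJ : IsOpen J) (hO : IsCompact O) (hOJ : O ⊆ J) :
    ∃ δ : ℝ, 0 < δ ∧ ∃ C, IsCompact C ∧ C ⊆ J ∧ ∃ O', IsCompact O' ∧ O' ⊆ J ∧ 1 ∉ O' ∧
      (0 ∈ O' → 0 ∈ O) ∧ ∃ H : AmbientIsotopy (I × I), H.SupportedOn (C ×ˢ univ) ∧
        ∀ p : I × I, p.1 ∈ O → (p.2 : ℝ) ≤ δ → (H 1 p).2 ≤ p.2 ∧ (H 1 p).1 ∈ O' := by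
  let f := unitInterval.symmHomeomorph
  have h0 : f 0 = 1 := unitInterval.symm_zero
  have h1 : f 1 = 0 := unitInterval.symm_one
  have hff : ∀ x, f (f x) = x := unitInterval.symm_symm
  have hpre : ∀ {S : Set I}, IsCompact S → IsCompact (f ⁻¹' S) := fun hS =>
    f.isCompact_preimage.2 hS
  have hpJ : ∀ {S : Set I}, S ⊆ f ⁻¹' J → f ⁻¹' S ⊆ J := fun hS x hx => by
    simpa [hff] using hS hx
  obtain ⟨δ, hδ, C, hC, hCJ, O', hO', hO'J, h0', h1', H, hs, hH⟩ :=
    exists_isotopy_avoid_zero (hJ.preimage f.continuous) (hpre hO) (preimage_mono hOJ)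
  refine ⟨δ, hδ, f ⁻¹' C, hpre hC, hpJ hCJ, f ⁻¹' O', hpre hO', hpJ hO'J, ?_, ?_,
    H.conj (f.prodCongr (Homeomorph.refl I)), ?_, fun p hpO hp => ?_⟩
  · rwa [mem_preimage, h1]
  · rw [mem_preimage, h0]
    intro h
    simpa [h1] using h1' h
  · exact (hs.conj _).mono fun p hp => ⟨hp.1, mem_univ _⟩
  · obtain ⟨h2, h3⟩ := hH (f p.1, p.2) (by rwa [mem_preimage, hff]) hp
    refine ⟨h2, ?_⟩
    change f (f (H 1 (f p.1, p.2)).1) ∈ O'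
    rwa [hff]

/-- Near the edge `{y = 0}` of the square, the first coordinate can be moved from any compact
subset of an open interval `J` of `[0, 1]` into any open subset of `J`, even if `J` contains end
points of `[0, 1]`. -/
theorem exists_isotopy_square {J O K : Set I} (hJ : IsOpen J) (hJc : J.OrdConnected)
    (hO : IsCompact O) (hOJ : O ⊆ J) (hK : IsOpen K) (hKn : K.Nonempty) (hKJ : K ⊆ J) :
    ∃ δ : ℝ, 0 < δ ∧ ∃ C, IsCompact C ∧ C ⊆ J ∧ ∃ H : AmbientIsotopy (I × I),
      H.SupportedOn (C ×ˢ univ) ∧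
        ∀ p : I × I, p.1 ∈ O → (p.2 : ℝ) ≤ δ → (H 1 p).2 ≤ p.2 ∧ (H 1 p).1 ∈ K := by
  obtain ⟨δ₀, hδ₀, C₀, hC₀, hC₀J, O₀, hO₀, hO₀J, h0, -, H₀, hs₀, hH₀⟩ :=
    exists_isotopy_avoid_zero hJ hO hOJ
  obtain ⟨δ₁, hδ₁, C₁, hC₁, hC₁J, O₁, hO₁, hO₁J, h1, h1', H₁, hs₁, hH₁⟩ :=
    exists_isotopy_avoid_one hJ hO₀ hO₀J
  have hKo : IsOpen (K ∩ Ioo 0 1) := hK.inter isOpen_Ioo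
  have hKn' : (K ∩ Ioo 0 1).Nonempty := by
    have hd : Dense (Ioo (0 : I) 1) := fun x => by
      rw [closure_Ioo zero_ne_one]
      exact ⟨unitInterval.nonneg', unitInterval.le_one'⟩
    exact hd.inter_open_nonempty K hK hKn
  have hJc' : (J ∩ Ioo 0 1).OrdConnected := hJc.inter ordConnected_Ioo
  obtain ⟨C₂, hC₂, hC₂J, H₂, hs₂, hH₂⟩ := exists_isotopy_interval (hJ.inter isOpen_Ioo) hJc'
    (fun h => lt_irrefl _ h.2.1) (fun h => lt_irrefl _ h.2.2) hO₁
    (fun x hx => ⟨hO₁J hx, unitInterval.pos_iff_ne_zero.2 fun h => h0 (h1' (h ▸ hx)),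
      unitInterval.lt_one_iff_ne_one.2 fun h => h1 (h ▸ hx)⟩) hKo hKn'
    (inter_subset_inter_left _ hKJ)
  refine ⟨min δ₀ δ₁, lt_min hδ₀ hδ₁, C₂ ∪ (C₁ ∪ C₀), hC₂.union (hC₁.union hC₀),
    union_subset (hC₂J.trans inter_subset_left) (union_subset hC₁J hC₀J),
    (H₂.prodRefl I).comp (H₁.comp H₀), ?_, fun p hpO hp => ?_⟩
  · rw [union_prod, union_prod]
    exact hs₂.prodRefl.comp (hs₁.comp hs₀)
  · obtain ⟨h3, h4⟩ := hH₀ p hpO (hp.trans (min_le_left _ _))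
    obtain ⟨h5, h6⟩ := hH₁ (H₀ 1 p) h4
      ((Subtype.coe_le_coe.2 h3).trans (hp.trans (min_le_right _ _)))
    exact ⟨h5.trans h3, (hH₂ _ h6).1⟩

/-! ### Isotopies of the Hilbert cube moving two coordinates -/

namespace AmbientIsotopy

/-- All maps of the isotopy are the identity outside one compact subset of `T`. -/
def CompactlySupportedIn {X : Type*} [TopologicalSpace X] (H : AmbientIsotopy X) (T : Set X) :
    Prop :=
  ∃ S, IsCompact S ∧ S ⊆ T ∧ H.SupportedOn S

theorem CompactlySupportedIn.comp {X : Type*} [TopologicalSpace X] {H G : AmbientIsotopy X}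
    {T : Set X} (hH : H.CompactlySupportedIn T) (hG : G.CompactlySupportedIn T) :
    (H.comp G).CompactlySupportedIn T := by
  obtain ⟨S, hS, hST, h⟩ := hH
  obtain ⟨S', hS', hST', h'⟩ := hG
  exact ⟨S ∪ S', hS.union hS', union_subset hST hST', h.comp h'⟩

theorem CompactlySupportedIn.mono {X : Type*} [TopologicalSpace X] {H : AmbientIsotopy X}
    {S T : Set X} (h : H.CompactlySupportedIn S) (hST : S ⊆ T) : H.CompactlySupportedIn T := by
  obtain ⟨K, hK, hKS, hHK⟩ := h
  exact ⟨K, hK, hKS.trans hST, hHK⟩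

theorem CompactlySupportedIn.apply_mem_iff {X : Type*} [TopologicalSpace X]
    {H : AmbientIsotopy X} {T : Set X} (h : H.CompactlySupportedIn T) (t : I) (x : X) :
    H t x ∈ T ↔ x ∈ T := by
  obtain ⟨S, -, hST, hS⟩ := h
  by_cases hx : x ∈ T
  · refine iff_of_true (by_contra fun hHx => hHx ?_) hx
    have h1 : H t (H t x) = H t x := hS t _ fun h' => hHx (hST h')
    rwa [(H.bijective_toFun t).1 h1]
  · rw [hS t x fun h' => hx (hST h')]

end AmbientIsotopy

namespace HilbertCube

/-- Replace the coordinates `i` and `j` of a point of the Hilbert cube. -/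
def updatePair (i j : ℕ) (q : HilbertCube) (p : I × I) : HilbertCube :=
  Function.update (Function.update q i p.1) j p.2

variable {i j : ℕ} (q : HilbertCube) (p : I × I)

theorem updatePair_left (hij : i ≠ j) : updatePair i j q p i = p.1 := by
  simp [updatePair, hij]

theorem updatePair_right : updatePair i j q p j = p.2 := by
  simp [updatePair]

theorem updatePair_of_ne {k : ℕ} (hi : k ≠ i) (hj : k ≠ j) : updatePair i j q p k = q k := by
  simp [updatePair, hi, hj]

theorem updatePair_self : updatePair i j q (q i, q j) = q := by
  simp [updatePair]

theorem updatePair_updatePair (hij : i ≠ j) (p' : I × I) :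
    updatePair i j (updatePair i j q p) p' = updatePair i j q p' := by
  ext k
  by_cases hi : k = i
  · subst hi; simp [updatePair_left, hij]
  · by_cases hj : k = j
    · subst hj; simp [updatePair_right]
    · simp [updatePair_of_ne, hi, hj]

end HilbertCube

namespace AmbientIsotopy

open HilbertCube

/-- The isotopy `H` of the square, acting on the coordinates `i` and `j` of the Hilbert cube, slowed
down at each point by the factor `χ`, which must not depend on the coordinates `i` and `j`. -/
def onCoordinates (H : AmbientIsotopy (I × I)) {i j : ℕ} (hij : i ≠ j) (χ : HilbertCube → I)
    (hχ : Continuous χ) (hχ' : ∀ q p, χ (updatePair i j q p) = χ q) :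
    AmbientIsotopy HilbertCube where
  toFun t q := updatePair i j q (H (t * χ q) (q i, q j))
  continuous_toFun := by
    have h : Continuous fun p : I × HilbertCube => H (p.1 * χ p.2) (p.2 i, p.2 j) :=
      H.continuous_toFun.comp (f := fun p : I × HilbertCube => (p.1 * χ p.2, (p.2 i, p.2 j)))
        (by fun_prop)
    exact (continuous_snd.update i h.fst).update j h.snd
  bijective_toFun t := by
    constructor
    · intro q q' h
      have hχq : χ q = χ q' := by
        have := congrArg χ h
        rwa [hχ', hχ'] at this
      have h1 : H (t * χ q) (q i, q j) = H (t * χ q) (q' i, q' j) := by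
        have hi := congrFun h i
        have hj := congrFun h j
        simp only [updatePair_left _ _ hij, updatePair_right] at hi hj
        rw [Prod.ext hi hj, hχq]
      have h2 := (H.bijective_toFun _).1 h1
      have h3 := congrArg (fun r => updatePair i j r (q i, q j)) h
      simp only [updatePair_updatePair _ _ hij] at h3
      rwa [updatePair_self, h2, updatePair_self] at h3
    · intro q
      obtain ⟨p, hp⟩ := (H.bijective_toFun (t * χ q)).2 (q i, q j)
      refine ⟨updatePair i j q p, ?_⟩
      simp only [hχ', updatePair_left _ _ hij, updatePair_right, updatePair_updatePair _ _ hij]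
      rw [Prod.mk.eta, hp, updatePair_self]
  toFun_zero q := by rw [zero_mul, H.toFun_zero, updatePair_self]

end AmbientIsotopy

open AmbientIsotopy HilbertCube

/-- A Urysohn function for a compact subset of an open set, with compact support. -/
theorem exists_cutoff {J B : Set I} (hJ : IsOpen J) (hB : IsCompact B) (hBJ : B ⊆ J) :
    ∃ L, IsCompact L ∧ L ⊆ J ∧ ∃ χ : C(I, I), (∀ x ∈ B, χ x = 1) ∧ ∀ x ∉ L, χ x = 0 := by
  obtain ⟨L, hL, hBL, hLJ⟩ := exists_compact_between hB hJ hBJ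
  obtain ⟨f, hf0, hf1, hf⟩ := exists_continuous_zero_one_of_isClosed
    isOpen_interior.isClosed_compl hB.isClosed (disjoint_compl_left_iff_subset.2 hBL)
  exact ⟨L, hL, hLJ, ⟨fun x => ⟨f x, hf x⟩, by fun_prop⟩, fun x hx => Subtype.ext (hf1 hx),
    fun x hx => Subtype.ext (hf0 fun h => hx (interior_subset h))⟩

/-- An isotopy of the square, supported over a compact subset of `J i`, can be made to act on the
coordinates `i` and `j` of the points of a given compact box, with compact support in the open box
`∏ J k`, provided that the latter does not restrict the coordinate `j`. -/
theorem exists_isotopy_onCoordinates {J B : ℕ → Set I} {F : Finset ℕ} (hJ : ∀ k, IsOpen (J k))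
    (hJF : ∀ k ∉ F, J k = univ) (hB : ∀ k, IsCompact (B k)) (hBJ : ∀ k, B k ⊆ J k) {i j : ℕ}
    (hij : i ≠ j) (hj : j ∉ F) {C : Set I} (hC : IsCompact C) (hCJ : C ⊆ J i)
    {H : AmbientIsotopy (I × I)} (hH : H.SupportedOn (C ×ˢ univ)) :
    ∃ Φ : AmbientIsotopy HilbertCube, Φ.CompactlySupportedIn (univ.pi J) ∧
      ∀ q : HilbertCube, (∀ k, k ≠ i → k ≠ j → q k ∈ B k) →
        Φ 1 q = updatePair i j q (H 1 (q i, q j)) := by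
  choose L hL hLJ χ hχ1 hχ0 using fun k => exists_cutoff (hJ k) (hB k) (hBJ k)
  have hne : ∀ k ∈ F.erase i, k ≠ i ∧ k ≠ j := fun k hk =>
    ⟨Finset.ne_of_mem_erase hk, fun h => hj (h ▸ Finset.mem_of_mem_erase hk)⟩
  refine ⟨H.onCoordinates hij (fun q => ∏ k ∈ F.erase i, χ k (q k))
    (continuous_finsetProd _ fun k _ => by fun_prop)
    (fun q p => Finset.prod_congr rfl fun k hk => by
      rw [updatePair_of_ne _ _ (hne k hk).1 (hne k hk).2]),
    ⟨univ.pi fun k => if k = i then C else if k ∈ F then L k else univ,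
      isCompact_univ_pi fun k => ?_, pi_mono fun k _ => ?_, fun t q hq => ?_⟩, fun q hq => ?_⟩
  · split_ifs
    exacts [hC, hL k, isCompact_univ]
  · split_ifs with h h'
    · exact h ▸ hCJ
    · exact hLJ k
    · rw [hJF k h']
  · obtain ⟨k, hk⟩ : ∃ k, q k ∉ (if k = i then C else if k ∈ F then L k else univ) := by
      simpa [mem_pi] using hq
    change updatePair i j q (H (t * ∏ k ∈ F.erase i, χ k (q k)) (q i, q j)) = q
    split_ifs at hk with h h'
    · rw [hH _ _ fun h' => hk (h ▸ h'.1), updatePair_self]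
    · rw [Finset.prod_eq_zero (Finset.mem_erase.2 ⟨h, h'⟩) (hχ0 k _ hk), mul_zero, H.toFun_zero,
        updatePair_self]
    · exact absurd (mem_univ _) hk
  · change updatePair i j q (H (1 * ∏ k ∈ F.erase i, χ k (q k)) (q i, q j)) = _
    rw [Finset.prod_eq_one fun k hk => hχ1 k _ (hq k (hne k hk).1 (hne k hk).2), one_mul]

/-- Near the face `{q j = 0}`, the points of a compact box can be moved so that their coordinate `i`
lies in a given set. -/
theorem exists_isotopy_move_coordinate {J B : ℕ → Set I} {F : Finset ℕ} (hJ : ∀ k, IsOpen (J k))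
    (hJc : ∀ k, (J k).OrdConnected) (hJF : ∀ k ∉ F, J k = univ) (hB : ∀ k, IsCompact (B k))
    (hBJ : ∀ k, B k ⊆ J k) {i j : ℕ} (hij : i ≠ j) (hj : j ∉ F) {N : Set I} (hNJ : N ⊆ J i)
    (hN : (interior N).Nonempty) :
    ∃ δ : ℝ, 0 < δ ∧ ∃ Φ : AmbientIsotopy HilbertCube, Φ.CompactlySupportedIn (univ.pi J) ∧
      ∀ q : HilbertCube, (∀ k ≠ j, q k ∈ B k) → (q j : ℝ) ≤ δ →
        Φ 1 q i ∈ N ∧ Φ 1 q j ≤ q j ∧ ∀ k, k ≠ i → k ≠ j → Φ 1 q k = q k := by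
  obtain ⟨δ, hδ, C, hC, hCJ, H, hs, hH⟩ := exists_isotopy_square (hJ i) (hJc i) (hB i) (hBJ i)
    isOpen_interior hN (interior_subset.trans hNJ)
  obtain ⟨Φ, hΦs, hΦ⟩ := exists_isotopy_onCoordinates hJ hJF hB hBJ hij hj hC hCJ hs
  refine ⟨δ, hδ, Φ, hΦs, fun q hq hqj => ?_⟩
  obtain ⟨h1, h2⟩ := hH (q i, q j) (hq i hij) hqj
  rw [hΦ q fun k _ hk => hq k hk]
  refine ⟨?_, ?_, fun k hi hj => updatePair_of_ne _ _ hi hj⟩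
  · rw [updatePair_left _ _ hij]
    exact interior_subset h2
  · rwa [updatePair_right]

/-- Near the face `{q z = 0}`, the points of a compact box can be moved so that finitely many of
their coordinates lie in given sets. -/
theorem exists_isotopy_move_coordinates {J O N : ℕ → Set I} {F : Finset ℕ}
    (hJ : ∀ k, IsOpen (J k)) (hJc : ∀ k, (J k).OrdConnected) (hJF : ∀ k ∉ F, J k = univ)
    (hO : ∀ k, IsCompact (O k)) (hOJ : ∀ k, O k ⊆ J k) {z : ℕ} (hz : z ∉ F)
    (hNc : ∀ k, IsCompact (N k)) (hNJ : ∀ k, N k ⊆ J k) (hN : ∀ k, (interior (N k)).Nonempty)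
    (G : Finset ℕ) (hzG : z ∉ G) :
    ∃ δ : ℝ, 0 < δ ∧ ∃ Φ : AmbientIsotopy HilbertCube, Φ.CompactlySupportedIn (univ.pi J) ∧
      ∀ q : HilbertCube, (∀ k ≠ z, q k ∈ O k) → (q z : ℝ) ≤ δ →
        Φ 1 q z ≤ q z ∧ (∀ k ∈ G, Φ 1 q k ∈ N k) ∧ ∀ k ∉ G, k ≠ z → Φ 1 q k = q k := by
  induction G using Finset.induction_on with
  | empty =>
    exact ⟨1, one_pos, .refl _, ⟨∅, isCompact_empty, empty_subset _, fun _ _ _ => rfl⟩,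
      fun q _ _ => ⟨le_rfl, by simp, fun _ _ _ => rfl⟩⟩
  | insert i G hi ih =>
    rw [Finset.mem_insert, not_or] at hzG
    obtain ⟨δ, hδ, Φ, hΦs, hΦ⟩ := ih hzG.2
    obtain ⟨δ', hδ', Ψ, hΨs, hΨ⟩ := exists_isotopy_move_coordinate
      (B := fun k => if k ∈ G then N k else O k) hJ hJc hJF
      (fun k => by split_ifs; exacts [hNc k, hO k]) (fun k => by split_ifs; exacts [hNJ k, hOJ k])
      (Ne.symm hzG.1) hz (hNJ i) (hN i)
    refine ⟨min δ δ', lt_min hδ hδ', Ψ.comp Φ, hΨs.comp hΦs, fun q hq hqz => ?_⟩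
    obtain ⟨h1, h2, h3⟩ := hΦ q hq (hqz.trans (min_le_left _ _))
    obtain ⟨h4, h5, h6⟩ := hΨ (Φ 1 q) (fun k hk => by
      split_ifs with h
      · exact h2 k h
      · rw [h3 k h hk]; exact hq k hk)
      ((Subtype.coe_le_coe.2 h1).trans (hqz.trans (min_le_right _ _)))
    refine ⟨h5.trans h1, fun k hk => ?_, fun k hk hkz => ?_⟩
    · rcases Finset.mem_insert.1 hk with rfl | hk
      · exact h4
      · rw [comp_apply, h6 k (fun h => hi (h ▸ hk)) fun h => hzG.2 (h ▸ hk)]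
        exact h2 k hk
    · rw [Finset.mem_insert, not_or] at hk
      rw [comp_apply, h6 k hk.1 hkz, h3 k hk.2 hkz]

/-- The part `{q z ≤ c}`, `c < 1`, of a compact box can be moved into any non-empty open subset of
an open box around it, if the latter does not restrict the coordinate `z`. -/
theorem exists_isotopy_cube {J O : ℕ → Set I} {F : Finset ℕ}
    (hJ : ∀ k, IsOpen (J k)) (hJc : ∀ k, (J k).OrdConnected) (hJF : ∀ k ∉ F, J k = univ)
    (hO : ∀ k, IsCompact (O k)) (hOJ : ∀ k, O k ⊆ J k) {z : ℕ} (hz : z ∉ F) {c : ℝ} (hc : c < 1)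
    {U : Set HilbertCube} (hU : IsOpen U) (hUn : U.Nonempty) (hUJ : U ⊆ univ.pi J) :
    ∃ Φ : AmbientIsotopy HilbertCube, Φ.CompactlySupportedIn (univ.pi J) ∧
      ∀ q : HilbertCube, (∀ k, q k ∈ O k) → (q z : ℝ) ≤ c → Φ 1 q ∈ U := by
  obtain ⟨u, hu⟩ := hUn
  obtain ⟨G, K, hK, hKU⟩ := isOpen_pi_iff.1 hU u hu
  have hN : ∀ k, ∃ N, IsCompact N ∧ u k ∈ interior N ∧ N ⊆ J k ∧ (k ∈ G → N ⊆ K k) := fun k => by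
    by_cases hk : k ∈ G
    · obtain ⟨N, h1, h2, h3⟩ := exists_compact_subset ((hK k hk).1.inter (hJ k))
        ⟨(hK k hk).2, hUJ hu k (mem_univ k)⟩
      exact ⟨N, h1, h2, h3.trans inter_subset_right, fun _ => h3.trans inter_subset_left⟩
    · obtain ⟨N, h1, h2, h3⟩ := exists_compact_subset (hJ k) (hUJ hu k (mem_univ k))
      exact ⟨N, h1, h2, h3, fun h => absurd h hk⟩
  choose N hNc hNu hNJ hNK using hN
  obtain ⟨w, hw⟩ := Infinite.exists_notMem_finset (insert z (G ∪ F))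
  simp only [Finset.mem_insert, Finset.mem_union, not_or] at hw
  obtain ⟨hwz, hwG, hwF⟩ := hw
  -- The last move uses the coordinate `w`, which `U` does not restrict, to correct `z`.
  obtain ⟨δ₂, hδ₂, Φ₂, hs₂, h₂⟩ := exists_isotopy_move_coordinate
    (B := fun k => if k = z then univ else if k ∈ G then N k else O k) hJ hJc hJF
    (fun k => by split_ifs; exacts [isCompact_univ, hNc k, hO k])
    (fun k => by split_ifs with h; exacts [by rw [h, hJF z hz], hNJ k, hOJ k])
    (Ne.symm hwz) hwF (hNJ z) ⟨_, hNu z⟩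
  have hw0 : (interior {x : I | (x : ℝ) ≤ δ₂}).Nonempty :=
    ⟨0, mem_interior_iff_mem_nhds.2
      ((continuous_subtype_val (p := (· ∈ I))).continuousAt.preimage_mem_nhds
        (Iic_mem_nhds (show ((0 : I) : ℝ) < δ₂ from hδ₂)))⟩
  -- Before that, `z` is used to correct all other coordinates in `G`, and to make `w` small.
  obtain ⟨δ₁, hδ₁, Φ₁, hs₁, h₁⟩ := exists_isotopy_move_coordinates
    (N := Function.update N w {x : I | (x : ℝ) ≤ δ₂}) hJ hJc hJF hO hOJ hz
    (fun k => by
      rcases eq_or_ne k w with rfl | h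
      · rw [Function.update_self]
        exact (isClosed_Iic.preimage continuous_subtype_val).isCompact
      · simpa [h] using hNc k)
    (fun k => by
      rcases eq_or_ne k w with rfl | h
      · simp [hJF k hwF]
      · simpa [h] using hNJ k)
    (fun k => by
      rcases eq_or_ne k w with rfl | h
      · simpa using hw0
      · simpa [h] using ⟨_, hNu k⟩)
    ((insert w G).erase z) (Finset.notMem_erase _ _)
  -- The first move makes `z` small.
  obtain ⟨H, -, hH, -⟩ := exists_isotopy_push_left (c := 0) le_rfl hδ₁ hc le_rfl
  obtain ⟨Φ₀, hs₀, h₀⟩ := exists_isotopy_onCoordinates (H := H.prodRefl I) hJ hJF hO hOJ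
    (Ne.symm hwz) hwF isCompact_univ (hJF z hz).ge
    fun t p hp => absurd ⟨mem_univ _, mem_univ _⟩ hp
  refine ⟨Φ₂.comp (Φ₁.comp Φ₀), hs₂.comp (hs₁.comp hs₀), fun q hq hqz => hKU ?_⟩
  have e := h₀ q fun k _ _ => hq k
  have hz₀ : (Φ₀ 1 q z : ℝ) ≤ δ₁ := by
    rw [e, updatePair_left _ _ (Ne.symm hwz)]
    exact hH _ hqz
  have hO₀ : ∀ k ≠ z, Φ₀ 1 q k ∈ O k := fun k hk => by
    rcases eq_or_ne k w with rfl | hkw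
    · rw [e, updatePair_right]; exact hq k
    · rw [e, updatePair_of_ne _ _ hk hkw]; exact hq k
  obtain ⟨-, hN₁, hO₁⟩ := h₁ (Φ₀ 1 q) hO₀ hz₀
  have hG₁ : ∀ k ∈ G, k ≠ z → Φ₁ 1 (Φ₀ 1 q) k ∈ N k := fun k hk hkz => by
    have := hN₁ k (Finset.mem_erase.2 ⟨hkz, Finset.mem_insert_of_mem hk⟩)
    have hkw : k ≠ w := fun h => hwG (h ▸ hk)
    rwa [Function.update_of_ne hkw] at this
  have hw₁ : (Φ₁ 1 (Φ₀ 1 q) w : ℝ) ≤ δ₂ := by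
    have := hN₁ w (Finset.mem_erase.2 ⟨hwz, Finset.mem_insert_self _ _⟩)
    rwa [Function.update_self] at this
  obtain ⟨hz₂, -, hG₂⟩ := h₂ (Φ₁ 1 (Φ₀ 1 q)) (fun k hkw => by
    split_ifs with hkz hk
    · exact mem_univ _
    · exact hG₁ k hk hkz
    · rw [hO₁ k (by simp [hk, hkw]) hkz]
      exact hO₀ k hkz) hw₁
  intro k hk
  refine hNK k hk ?_
  rcases eq_or_ne k z with rfl | hkz
  · exact hz₂
  · rw [comp_apply, comp_apply, hG₂ k hkz fun h => hwG (h ▸ hk)]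
    exact hG₁ k hk hkz

/-! ### From isotopies to the homeomorphism group -/

namespace AmbientIsotopy

variable {X Y : Type*} [TopologicalSpace X] [TopologicalSpace Y]

/-- The homeomorphisms of a compact Hausdorff space making up an isotopy. -/
noncomputable def toHomeomorph [CompactSpace X] [T2Space X] (H : AmbientIsotopy X) (t : I) :
    X ≃ₜ X :=
  Continuous.homeoOfEquivCompactToT2 (f := Equiv.ofBijective (H t) (H.bijective_toFun t))
    (H.continuous_toFun.comp (Continuous.prodMk_right t))

theorem continuous_toHomeomorph_symm [CompactSpace X] [T2Space X] (H : AmbientIsotopy X) :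
    Continuous fun p : I × X => (H.toHomeomorph p.1).symm p.2 := by
  -- The map `(t, x) ↦ (t, Hₜ x)` is a continuous bijection of the compact space `I × X`.
  let e : I × X ≃ I × X :=
    { toFun := fun p => (p.1, H.toHomeomorph p.1 p.2)
      invFun := fun p => (p.1, (H.toHomeomorph p.1).symm p.2)
      left_inv := fun p => by
        ext
        · rfl
        · exact (H.toHomeomorph p.1).symm_apply_apply p.2
      right_inv := fun p => by
        ext
        · rfl
        · exact (H.toHomeomorph p.1).apply_symm_apply p.2 }
  have he : Continuous e := continuous_fst.prodMk H.continuous_toFun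
  exact (Continuous.homeoOfEquivCompactToT2 he).symm.continuous.snd

theorem toHomeomorph_mem_homeoZero [CompactSpace X] [T2Space X] (H : AmbientIsotopy X) :
    H.toHomeomorph 1 ∈ HomeoZero X := by
  have hc : Continuous H.toHomeomorph :=
    HomeoGroup.isInducing_toPair.continuous_iff.2
      ((ContinuousMap.curry ⟨_, H.continuous_toFun⟩).continuous.prodMk
        (ContinuousMap.curry ⟨_, H.continuous_toHomeomorph_symm⟩).continuous)
  have h0 : H.toHomeomorph 0 = 1 := Homeomorph.ext fun x => H.toFun_zero x
  exact ⟨⟨⟨H.toHomeomorph, hc⟩, h0, rfl⟩⟩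

open Classical in
/-- An isotopy of the model space of a chart, compactly supported in the target of the chart,
transferred to the source and extended by the identity. -/
noncomputable def transfer [T2Space X] (Φ : AmbientIsotopy Y) (e : OpenPartialHomeomorph X Y)
    (hΦ : Φ.CompactlySupportedIn e.target) : AmbientIsotopy X where
  toFun t x := if x ∈ e.source then e.symm (Φ t (e x)) else x
  continuous_toFun := by
    have hmem := fun t y => (hΦ.apply_mem_iff t y).2
    obtain ⟨S, hSc, hSe, hS⟩ := hΦ
    have hK : IsClosed (e.symm '' S) :=
      (hSc.image_of_continuousOn (e.continuousOn_symm.mono hSe)).isClosed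
    refine continuous_iff_continuousAt.2 fun ⟨t, x⟩ => ?_
    by_cases hx : x ∈ e.source
    · have hnhds : univ ×ˢ e.source ∈ 𝓝 (t, x) :=
        prod_mem_nhds Filter.univ_mem (e.open_source.mem_nhds hx)
      have h1 : ContinuousAt (fun p : I × X => e.symm (Φ p.1 (e p.2))) (t, x) := by
        refine ContinuousAt.comp (g := e.symm) (e.continuousAt_symm (hmem t _ (e.map_source hx)))
          ?_
        exact ContinuousAt.comp (g := fun p : I × Y => Φ p.1 p.2)
          (f := fun p : I × X => (p.1, e p.2)) Φ.continuous_toFun.continuousAt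
          (continuousAt_fst.prodMk
            (ContinuousAt.comp (g := e) (e.continuousAt hx) continuousAt_snd))
      refine h1.congr ?_
      filter_upwards [hnhds] with p hp
      rw [if_pos hp.2]
    · have hxK : x ∈ (e.symm '' S)ᶜ := by
        rintro ⟨y, hy, rfl⟩
        exact hx (e.map_target (hSe hy))
      have hnhds : univ ×ˢ (e.symm '' S)ᶜ ∈ 𝓝 (t, x) :=
        prod_mem_nhds Filter.univ_mem (hK.isOpen_compl.mem_nhds hxK)
      refine (continuousAt_snd (X := I) (p := (t, x))).congr ?_
      filter_upwards [hnhds] with p hp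
      split_ifs with hps
      · rw [hS p.1 (e p.2) fun h => hp.2 ⟨_, h, e.left_inv hps⟩, e.left_inv hps]
      · rfl
  bijective_toFun t := by
    have hmem := fun t y => (hΦ.apply_mem_iff t y).2
    constructor
    · intro x x' h
      simp only at h
      split_ifs at h with hx hx' hx'
      · have h1 := e.symm.injOn (hmem t _ (e.map_source hx)) (hmem t _ (e.map_source hx')) h
        exact e.injOn hx hx' ((Φ.bijective_toFun t).1 h1)
      · exact absurd (h ▸ e.map_target (hmem t _ (e.map_source hx))) hx'
      · exact absurd (h ▸ e.map_target (hmem t _ (e.map_source hx'))) hx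
      · exact h
    · intro x
      by_cases hx : x ∈ e.source
      · obtain ⟨y, hy⟩ := (Φ.bijective_toFun t).2 (e x)
        have hye : y ∈ e.target := (hΦ.apply_mem_iff t y).1 (hy ▸ e.map_source hx)
        exact ⟨e.symm y, by
          simp only
          rw [if_pos (e.map_target hye), e.right_inv hye, hy, e.left_inv hx]⟩
      · exact ⟨x, if_neg hx⟩
  toFun_zero x := by
    split_ifs with hx
    · rw [Φ.toFun_zero, e.left_inv hx]
    · rfl

theorem transfer_apply [T2Space X] (Φ : AmbientIsotopy Y) (e : OpenPartialHomeomorph X Y)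
    (hΦ : Φ.CompactlySupportedIn e.target) (t : I) {x : X} (hx : x ∈ e.source) :
    Φ.transfer e hΦ t x = e.symm (Φ t (e x)) :=
  if_pos hx

end AmbientIsotopy

open AmbientIsotopy

/-! ### Absorption of small neighbourhoods -/

/-- A Hilbert cube manifold has, at each point, a chart in the Hilbert cube in which no coordinate
of the point is `1`. -/
theorem IsHilbertCubeManifold.exists_chart {M : Type*} [TopologicalSpace M]
    (hM : IsHilbertCubeManifold M) (x : M) :
    ∃ e : OpenPartialHomeomorph M HilbertCube, x ∈ e.source ∧ ∀ k, e x k ≠ 1 := by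
  obtain ⟨U, hU, hxU, V, hV, ⟨f⟩⟩ := hM x
  have : Nonempty U := ⟨⟨x, hxU⟩⟩
  have : Nonempty V := ⟨f ⟨x, hxU⟩⟩
  let e := (hU.isOpenEmbedding_subtypeVal.toOpenPartialHomeomorph Subtype.val).symm.trans
    (f.toOpenPartialHomeomorph.trans
      (hV.isOpenEmbedding_subtypeVal.toOpenPartialHomeomorph Subtype.val))
  have hxe : x ∈ e.source := by simp [e, hxU]
  -- Reflect the coordinates of `e x` which are equal to `1`.
  classical
  let ρ : HilbertCube ≃ₜ HilbertCube := Homeomorph.piCongrRight fun k =>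
    if e x k = 1 then unitInterval.symmHomeomorph else Homeomorph.refl I
  refine ⟨e.trans ρ.toOpenPartialHomeomorph, by simpa using hxe, fun k => ?_⟩
  change (if e x k = 1 then unitInterval.symmHomeomorph else Homeomorph.refl I) (e x k) ≠ 1
  split_ifs with h
  · rw [h]
    change unitInterval.symm 1 ≠ 1
    simp
  · exact h

/-- Each point of a compact Hilbert cube manifold has an open neighbourhood `V` and a neighbourhood
`A` which can be moved into every non-empty open subset of `V`. -/
theorem IsHilbertCubeManifold.exists_absorbed_nhds {M : Type*} [TopologicalSpace M] [T2Space M]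
    [CompactSpace M] (hM : IsHilbertCubeManifold M) (x : M) :
    ∃ A ∈ 𝓝 x, ∃ V, IsOpen V ∧ x ∈ V ∧ ∀ U ⊆ V, IsOpen U → U.Nonempty →
      ∃ g : HomeoZero M, ∀ y ∈ A, g • y ∈ U := by
  obtain ⟨e, hxe, hx1⟩ := hM.exists_chart x
  obtain ⟨F, T, hT, hTe⟩ := isOpen_pi_iff.1 e.open_target (e x) (e.map_source hxe)
  -- An open box in the target of the chart, restricting only the coordinates in `F`.
  have hJ : ∀ k, ∃ J : Set I, IsOpen J ∧ J.OrdConnected ∧ e x k ∈ J ∧ (k ∈ F → J ⊆ T k) ∧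
      (k ∉ F → J = univ) := fun k => by
    by_cases hk : k ∈ F
    · obtain ⟨r, hr, hrT⟩ := Metric.isOpen_iff.1 (hT k hk).1 _ (hT k hk).2
      refine ⟨Metric.ball (e x k) r, Metric.isOpen_ball, ?_, Metric.mem_ball_self hr, fun _ => hrT,
        fun h => absurd hk h⟩
      have : Metric.ball (e x k) r = Subtype.val ⁻¹' Metric.ball (e x k : ℝ) r := rfl
      rw [this, Real.ball_eq_Ioo]
      exact ordConnected_Ioo.preimage_mono (Subtype.mono_coe _)
    · exact ⟨univ, isOpen_univ, ordConnected_univ, mem_univ _, fun h => absurd h hk, fun _ => rfl⟩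
  choose J hJo hJc hxJ hJT hJF using hJ
  choose O hO hxO hOJ using fun k => exists_compact_subset (hJo k) (hxJ k)
  obtain ⟨z, hz⟩ := Infinite.exists_notMem_finset F
  obtain ⟨c, hxc, hc⟩ := exists_between
    (unitInterval.coe_lt_one.2 (unitInterval.lt_one_iff_ne_one.2 (hx1 z)))
  have hJe : univ.pi J ⊆ e.target := fun q hq => hTe fun k hk => hJT k hk (hq k (mem_univ k))
  have hJ_open : IsOpen (univ.pi J) := by
    have : univ.pi J = (F : Set ℕ).pi J := by
      ext q
      refine ⟨fun h k _ => h k (mem_univ k), fun h k _ => ?_⟩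
      by_cases hk : k ∈ F
      · exact h k hk
      · rw [hJF k hk]; exact mem_univ _
    rw [this]
    exact isOpen_set_pi F.finite_toSet fun k _ => hJo k
  have hA : {q : HilbertCube | (∀ k ∈ F, q k ∈ O k) ∧ (q z : ℝ) ≤ c} ∈ 𝓝 (e x) := by
    refine Filter.inter_mem (set_pi_mem_nhds F.finite_toSet fun k _ =>
      mem_interior_iff_mem_nhds.1 (hxO k)) ?_
    have hcont : Continuous fun q : HilbertCube => (q z : ℝ) := by fun_prop
    exact hcont.continuousAt.preimage_mem_nhds (Iic_mem_nhds hxc)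
  have he := e.continuousAt hxe
  refine ⟨e.source ∩ e ⁻¹' _, Filter.inter_mem (e.open_source.mem_nhds hxe)
    (he.preimage_mem_nhds hA), e.source ∩ e ⁻¹' univ.pi J,
    e.isOpen_inter_preimage hJ_open, ⟨hxe, fun k _ => hxJ k⟩, fun U hUV hU hUn => ?_⟩
  classical
  obtain ⟨Φ, hΦs, hΦ⟩ := exists_isotopy_cube
    (O := fun k => if k ∈ F then O k else univ) hJo hJc hJF
    (fun k => by split_ifs; exacts [hO k, isCompact_univ])
    (fun k => by split_ifs with h; exacts [hOJ k, (hJF k h).ge]) hz hc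
    (e.isOpen_image_of_subset_source hU (hUV.trans inter_subset_left)) (hUn.image e)
    (image_subset_iff.2 (hUV.trans inter_subset_right))
  refine ⟨⟨_, (Φ.transfer e (hΦs.mono hJe)).toHomeomorph_mem_homeoZero⟩,
    fun y hy => ?_⟩
  change Φ.transfer e (hΦs.mono hJe) 1 y ∈ U
  rw [transfer_apply _ _ _ _ hy.1]
  obtain ⟨u, hu, hue⟩ := hΦ (e y) (fun k => by
    split_ifs with h
    exacts [hy.2.1 k h, mem_univ _]) hy.2.2
  rwa [← hue, e.left_inv (hUV hu).1]

theorem continuous_homeoZero_smul {M : Type*} [TopologicalSpace M] [LocallyCompactSpace M]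
    (g : HomeoZero M) : Continuous fun x : M => g • x :=
  g.1.continuous

/-- In a connected compact Hilbert cube manifold, each point has a neighbourhood which can be moved
into every non-empty open subset of the manifold. -/
theorem IsHilbertCubeManifold.exists_nhds_absorbed {M : Type*} [TopologicalSpace M] [T2Space M]
    [CompactSpace M] [ConnectedSpace M] (hM : IsHilbertCubeManifold M) (x : M) :
    ∃ A ∈ 𝓝 x, ∀ U : Set M, IsOpen U → U.Nonempty → ∃ g : HomeoZero M, ∀ y ∈ A, g • y ∈ U := by
  choose A hA V hVo hV hAV using hM.exists_absorbed_nhds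
  -- If `V x` meets a translate of `U`, then `A x` can be moved into `U`.
  have key : ∀ U : Set M, IsOpen U → ∀ x, (∃ y ∈ V x, ∃ g : HomeoZero M, g • y ∈ U) →
      ∃ g : HomeoZero M, ∀ y ∈ A x, g • y ∈ U := by
    rintro U hU x ⟨y, hy, g, hgy⟩
    obtain ⟨h, hh⟩ := hAV x (V x ∩ (fun y => g • y) ⁻¹' U) inter_subset_left
      ((hVo x).inter (hU.preimage (continuous_homeoZero_smul g))) ⟨y, hy, hgy⟩
    exact ⟨g * h, fun w hw => by rw [mul_smul]; exact (hh w hw).2⟩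
  refine ⟨A x, hA x, fun U hU hUn => key U hU x ?_⟩
  -- The union of the translates of `U` is open and closed.
  let W : Set M := {y | ∃ g : HomeoZero M, g • y ∈ U}
  have hWo : IsOpen W := by
    have : W = ⋃ g : HomeoZero M, (fun y => g • y) ⁻¹' U := by ext; simp [W]
    rw [this]
    exact isOpen_iUnion fun g => hU.preimage (continuous_homeoZero_smul g)
  have hWc : IsClosed W := isClosed_of_closure_subset fun y hy => by
    obtain ⟨w, hwV, hwW⟩ := mem_closure_iff_nhds.1 hy _ ((hVo y).mem_nhds (hV y))
    obtain ⟨g, hg⟩ := key U hU y ⟨w, hwV, hwW⟩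
    exact ⟨g, hg y (mem_of_mem_nhds (hA y))⟩
  have hW : W = univ := IsClopen.eq_univ ⟨hWc, hWo⟩
    (hUn.mono fun y hy => ⟨1, by rwa [one_smul]⟩)
  exact ⟨x, hV x, hW.ge (mem_univ x)⟩

theorem lemma3p7 (M : Type*) [TopologicalSpace M] [T2Space M] [CompactSpace M] [ConnectedSpace M]
    (hM : IsHilbertCubeManifold M) :
    HasFiniteFillingProperty (HomeoZero M) M := by
  choose A hA h using hM.exists_nhds_absorbed
  obtain ⟨t, -, ht⟩ := isCompact_univ.elim_nhds_subcover A fun x _ => hA x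
  refine ⟨t.card, fun U hU hUn => ?_⟩
  choose g hg using fun x => h x U hU hUn
  refine ⟨fun i => (g (t.equivFin.symm i))⁻¹, eq_univ_of_forall fun y => ?_⟩
  obtain ⟨x, hx, hy⟩ := mem_iUnion₂.1 (ht (mem_univ y))
  refine mem_iUnion.2 ⟨t.equivFin ⟨x, hx⟩, g x • y, hg x y hy, ?_⟩
  simp
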